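/- Let $q$ be an indeterminate (or any element of a commutative ring). Identify a partition with its Ferrers diagram, write $|\lambda|$ for the number of cells of $\lambda$, and let $\delta_k=(k,k-1,\dots,1)$ be the staircase partition, with $\delta_0=\emptyset$. For $k\ge 1$, a $\delta_k^+$-configuration is a pair $(\lambda,A)$ consisting of a partition $\lambda\subset\delta_{k-1}$ and a set $A$ of arrows, where each arrow is either horizontal and occupies a whole row of $\delta_k/\lambda$, or vertical and occupies a whole column of $\delta_k/\lambda$ (a horizontal and a vertical arrow are always different, and there is at most one horizontal arrow in each row and at most one vertical arrow in each column), such that no outer corner of $\delta_k/\lambda$ is occupied by two arrows. Here an outer corner is a cell $c\in\delta_k/\lambda$ such that $\lambda\cup\{c\}$ is a partition. For $k=0$ the only $\delta_0^+$-configuration is $(\emptyset,\emptyset)$. Let $\Delta_k^+$ be the (finite) set of $\delta_k^+$-configurations. The length of an arrow is the number of cells it occupies, $\|A\|$ is the sum of the lengths of the arrows in $A$, and the $q$-weight of $C=(\lambda,A)$ is $$\mathrm{wt}_q(C)=(-1)^{|A|}\,q^{\,2|\lambda|+\|A\|}.$$ Theorem. For every integer $k\ge 0$, $$\sum_{C\in\Delta_k^+}\mathrm{wt}_q(C)=\sum_{i=-k}^{k}(-q)^{i^2}.$$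 Equivalently, since $\Delta_0^+$ contains only $(\emptyset,\emptyset)$, which has weight $1$, for every $k\ge 1$, $$\sum_{C\in\Delta_k^+}\mathrm{wt}_q(C)=\sum_{C\in\Delta_{k-1}^+}\mathrm{wt}_q(C)+2(-q)^{k^2}.$$ -/

import Mathlib

namespace DeltaConfig

/-- The staircase partition `(k, k-1, …, 1)`, as a Young diagram. Rows and columns are numbered
from `0`, so its cells are the pairs `(i, j)` with `i + j < k`. -/
def staircase (k : ℕ) : YoungDiagram where
  cells := (Finset.range k ×ˢ Finset.range k).filter fun c => c.1 + c.2 < k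
  isLowerSet := by
    intro a b hba ha
    have h1 : b.1 ≤ a.1 := hba.1
    have h2 : b.2 ≤ a.2 := hba.2
    simp only [Finset.coe_filter, Finset.mem_product, Finset.mem_range, Set.mem_ofPred_eq] at ha ⊢
    omega

theorem mem_staircase {k : ℕ} {c : ℕ × ℕ} : c ∈ staircase k ↔ c.1 + c.2 < k := by
  rw [← YoungDiagram.mem_cells]
  simp only [staircase, Finset.mem_filter, Finset.mem_product, Finset.mem_range]
  omega

/-- The row lengths of the staircase are `k, k-1, …, 1`. -/
theorem rowLen_staircase (k i : ℕ) : (staircase k).rowLen i = k - i := by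
  have h : ∀ j, j < (staircase k).rowLen i ↔ j < k - i := fun j => by
    rw [← YoungDiagram.mem_iff_lt_rowLen, mem_staircase]
    simp only
    omega
  have h1 := h (k - i)
  have h2 := h ((staircase k).rowLen i)
  omega

/-- The cells of the skew diagram `δ_k / lam`. -/
def skewCells (k : ℕ) (lam : YoungDiagram) : Finset (ℕ × ℕ) :=
  (staircase k).cells \ lam.cells

/-- An arrow: `Sum.inl i` is the horizontal arrow in row `i`, and `Sum.inr j` is the vertical arrow
in column `j`. -/
abbrev Arrow (k : ℕ) : Type := Fin k ⊕ Fin k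

/-- The cells occupied by an arrow: a whole row or a whole column of `δ_k / lam`. -/
def Arrow.cells {k : ℕ} (lam : YoungDiagram) : Arrow k → Finset (ℕ × ℕ)
  | Sum.inl i => (skewCells k lam).filter fun c => c.1 = i
  | Sum.inr j => (skewCells k lam).filter fun c => c.2 = j

/-- The length of an arrow is the number of cells it occupies. -/
def Arrow.length {k : ℕ} (lam : YoungDiagram) (u : Arrow k) : ℕ :=
  (Arrow.cells lam u).card

/-- An outer corner of `δ_k / lam`: a cell `c` of `δ_k / lam` such that `lam ∪ {c}` is (the Ferrers
diagram of) a partition. -/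
def IsOuterCorner (k : ℕ) (lam : YoungDiagram) (c : ℕ × ℕ) : Prop :=
  c ∈ skewCells k lam ∧ IsLowerSet ((insert c lam.cells : Finset (ℕ × ℕ)) : Set (ℕ × ℕ))

/-- A `δ_k⁺`-configuration: a partition contained in `δ_{k-1}` and a set of arrows, each occupying a
whole row or a whole column of `δ_k / lam`, such that no outer corner is occupied by two arrows.
For `k = 0` the partition is empty. -/
@[ext]
structure DeltaPlus (k : ℕ) where
  shape : YoungDiagram
  arrows : Finset (Arrow k)
  shape_le : shape ≤ staircase (k - 1)
  no_forbidden_corner : ∀ c, IsOuterCorner k shape c →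
    ∀ u ∈ arrows, ∀ v ∈ arrows,
      c ∈ Arrow.cells shape u → c ∈ Arrow.cells shape v → u = v

instance DeltaPlus.instFinite (k : ℕ) : Finite (DeltaPlus k) := by
  let f : DeltaPlus k → {s // s ∈ (staircase (k - 1)).cells.powerset} × Finset (Arrow k) :=
    fun C => (⟨C.shape.cells, Finset.mem_powerset.2 (YoungDiagram.cells_subset_iff.2 C.shape_le)⟩,
      C.arrows)
  refine Finite.of_injective f fun C D h => ?_
  simp only [f, Prod.mk.injEq, Subtype.mk.injEq] at h
  exact DeltaPlus.ext (YoungDiagram.ext h.1) h.2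

noncomputable instance DeltaPlus.instFintype (k : ℕ) : Fintype (DeltaPlus k) :=
  Fintype.ofFinite _

/-- `‖A‖`, the sum of the arrow lengths. -/
def DeltaPlus.arrowNorm {k : ℕ} (C : DeltaPlus k) : ℕ :=
  ∑ u ∈ C.arrows, Arrow.length C.shape u

/-- The `q`-weight `(-1)^|A| q^(2|lam| + ‖A‖)`. -/
def DeltaPlus.qWeight {k : ℕ} {R : Type*} [CommRing R] (q : R) (C : DeltaPlus k) : R :=
  (-1) ^ C.arrows.card * q ^ (2 * C.shape.card + C.arrowNorm)

end DeltaConfig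

/-!
Let `W a b` (`partialSum`) be the generating function of the configurations with `a` rows and `b`
columns: shapes inside `δ_{a-1}` with at most `b` columns, horizontal arrows in the first `a` rows
of `δ_a`, vertical arrows in its first `b` columns. The sum over all `δ_k⁺`-configurations is
`W k k`. In terms of the lattice path that bounds the shape, `W a b` counts paths with `a` up steps
and `b` right steps, and looking at the last step gives a recurrence (`partialSum_succ_succ`): either
the first row of the shape has length `b + 1` and can be removed, or the last column is empty and can
be removed. The term `-q^(2(a+1)) W a b` accounts for the outer corner which the two arrows may not
share.

Put `p = q⁻¹`. After a rescaling, `W` is the array of partial path sums of a T-fraction with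
coefficients `(1 - p^h)²`, and these path sums are, up to explicit factors, the values `L(z^n P_h)`,
where `P_h` are the polynomials with
`P_{h+2} = (1 + z) P_{h+1} - (1 - p^(h+1))² z P_h` (`denomPoly`) and `L` is the functional of moments.
So the theorem is equivalent to the assertion that the functional `L` with moments
`L(z^n) = p^(n(n+1)) ∑_{|i| ≤ n} (-q)^(i²)` (`momentFunctional`) satisfies `L(P_h) = ((p; p)_h)²` for
all `h`; see `eq_thetaSum_of_recurrence`.

The evaluation of `L(P_h)` rests on three facts. The relation between consecutive partial theta sums
says that `L(z f(z)) = p² L(f(p² z)) - 2p f(-p)` (`momentFunctional_X_mul`). The polynomials satisfy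
`P_h(-p) = (p; p)_h` (`denomPoly_eval`). Finally `P_{h+1}(p² z) - (1 - p^(h+1)) P_h(p² z)` is an
explicit combination of `P_{h+1}(z)` and `z P_h(z)` (`dilate_denomPoly`). Together with the three-term
recurrence they give a closed system of recurrences for `L(P_h)` and `L(z P_h)`, which has an explicit
solution (`momentFunctional_denomPoly_aux`).

This argument needs `q` to be invertible with `q² ≠ 1`. It is applied to the indeterminate in the
fraction field of `ℤ[X]`, and the identity in `ℤ[X]` specializes to every commutative ring.
-/

namespace DeltaConfig

/-! ### Partial theta sums and `q`-factorials -/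

open Polynomial

/-- The truncated theta series `∑_{|i| ≤ k} (-q)^(i²)`. -/
noncomputable def thetaSum {R : Type*} [CommRing R] (q : R) (k : ℕ) : R :=
  ∑ i ∈ Finset.Icc (-(k : ℤ)) (k : ℤ), (-q) ^ (i.natAbs ^ 2)

theorem thetaSum_zero {R : Type*} [CommRing R] (q : R) : thetaSum q 0 = 1 := by
  simp [thetaSum]

theorem thetaSum_succ {R : Type*} [CommRing R] (q : R) (k : ℕ) :
    thetaSum q (k + 1) = thetaSum q k + 2 * (-q) ^ ((k + 1) ^ 2) := by
  have h : Finset.Icc (-((k + 1 : ℕ) : ℤ)) ((k + 1 : ℕ) : ℤ) =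
      insert (-((k + 1 : ℕ) : ℤ)) (insert ((k + 1 : ℕ) : ℤ) (Finset.Icc (-(k : ℤ)) (k : ℤ))) := by
    ext i
    simp only [Finset.mem_Icc, Finset.mem_insert]
    omega
  rw [thetaSum, h, Finset.sum_insert, Finset.sum_insert, Int.natAbs_neg, Int.natAbs_natCast,
    thetaSum]
  · ring
  · simp only [Finset.mem_Icc]
    omega
  · simp only [Finset.mem_Icc, Finset.mem_insert]
    omega

/-- The `q`-factorial `(q; q)_n = (1 - q)(1 - q²)⋯(1 - q^n)`. -/
def qPoch {R : Type*} [CommRing R] (q : R) (n : ℕ) : R :=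
  ∏ j ∈ Finset.range n, (1 - q ^ (j + 1))

theorem qPoch_zero {R : Type*} [CommRing R] (q : R) : qPoch q 0 = 1 := by
  simp [qPoch]

theorem qPoch_succ {R : Type*} [CommRing R] (q : R) (n : ℕ) :
    qPoch q (n + 1) = qPoch q n * (1 - q ^ (n + 1)) := Finset.prod_range_succ _ _

/-! ### The denominator polynomials of the T-fraction -/

/-- The denominators `P_n(z)` of the convergents of the T-fraction with coefficients `(1 - p^h)²`. -/
noncomputable def denomPoly {R : Type*} [CommRing R] (p : R) : ℕ → R[X]
  | 0 => 1
  | 1 => 1 + X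
  | n + 2 => (1 + X) * denomPoly p (n + 1) - C ((1 - p ^ (n + 1)) ^ 2) * X * denomPoly p n

theorem denomPoly_eval {R : Type*} [CommRing R] (p : R) :
    ∀ n, (denomPoly p n).eval (-p) = qPoch p n
  | 0 => by simp [denomPoly, qPoch_zero]
  | 1 => by simp [denomPoly, qPoch, sub_eq_add_neg]
  | n + 2 => by
    simp only [denomPoly, eval_sub, eval_mul, eval_add, eval_one, eval_X, eval_C,
      denomPoly_eval p (n + 1), denomPoly_eval p n, qPoch_succ]
    ring

/-- The dilation `f(z) ↦ f(p² z)`. -/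
noncomputable def dilate {R : Type*} [CommRing R] (p : R) (f : R[X]) : R[X] :=
  f.comp (C (p ^ 2) * X)

/-- The first identity is the one of interest. Its induction step produces
`(1 + p z) P_{n+1}(p² z)`, which the second identity expresses through undilated polynomials; neither
can be proved without the other. -/
theorem dilate_denomPoly_aux {R : Type*} [CommRing R] (p : R) (n : ℕ) :
    dilate p (denomPoly p (n + 1)) = C (1 - p ^ (n + 1)) * dilate p (denomPoly p n) +
      C (p ^ (n + 1)) * denomPoly p (n + 1) -
      C (p ^ (n + 1) * (1 - p ^ (n + 1))) * X * denomPoly p n ∧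
    (1 + C p * X) * dilate p (denomPoly p (n + 1)) = denomPoly p (n + 2) -
      C ((1 - p ^ (n + 2)) + p * (1 - p ^ (n + 1))) * X * denomPoly p (n + 1) +
      C (p * (1 - p ^ (n + 1)) ^ 2) * X ^ 2 * denomPoly p n := by
  induction n with
  | zero =>
    simp only [denomPoly, dilate, add_comp, one_comp, X_comp, map_sub, map_mul, map_pow, map_add,
      map_one]
    constructor <;> ring
  | succ n ih =>
    obtain ⟨h1, h2⟩ := ih
    have h0 : dilate p (denomPoly p (n + 2)) =
        (1 + C (p ^ 2) * X) * dilate p (denomPoly p (n + 1)) -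
        C ((1 - p ^ (n + 1)) ^ 2) * (C (p ^ 2) * X) * dilate p (denomPoly p n) := by
      simp only [denomPoly, dilate, sub_comp, mul_comp, add_comp, one_comp, X_comp, C_comp]
    have h3 : denomPoly p (n + 3) = (1 + X) * denomPoly p (n + 2) -
      C ((1 - p ^ (n + 2)) ^ 2) * X * denomPoly p (n + 1) := rfl
    have h4 : denomPoly p (n + 2) = (1 + X) * denomPoly p (n + 1) -
      C ((1 - p ^ (n + 1)) ^ 2) * X * denomPoly p n := rfl
    generalize dilate p (denomPoly p (n + 2)) = D2 at *
    generalize dilate p (denomPoly p (n + 1)) = D1 at *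
    generalize dilate p (denomPoly p n) = D0 at *
    rw [h3]
    generalize denomPoly p (n + 2) = P2 at *
    generalize denomPoly p (n + 1) = P1 at *
    generalize denomPoly p n = P0 at *
    simp only [map_sub, map_mul, map_pow, map_add, map_one] at *
    generalize (C p : R[X]) = p at *
    -- `h1` removes `P_n(p² z)` from the recurrence `h0`; the remaining multiple of
    -- `(1 + p z) P_{n+1}(p² z)` is evaluated by `h2`.
    have g1 : D2 = (1 - p ^ (n + 2)) * D1 + p ^ (n + 2) * P2
        - p ^ (n + 2) * (1 - p ^ (n + 2)) * X * P1 := by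
      linear_combination h0 + (1 - p ^ (n + 1)) * p ^ 2 * X * h1 + p ^ (n + 2) * h2
    refine ⟨g1, ?_⟩
    linear_combination (1 + p * X) * g1 + (1 - p ^ (n + 2)) * h2 +
      p * (1 - p ^ (n+2)) * X * h4

theorem dilate_denomPoly {R : Type*} [CommRing R] (p : R) (n : ℕ) :
    dilate p (denomPoly p (n + 1)) = C (1 - p ^ (n + 1)) * dilate p (denomPoly p n) +
      C (p ^ (n + 1)) * denomPoly p (n + 1) -
      C (p ^ (n + 1) * (1 - p ^ (n + 1))) * X * denomPoly p n :=
  (dilate_denomPoly_aux p n).1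

/-! ### The moment functional -/

section Field
variable {K : Type*} [Field K]

/-- The linear functional `L` on polynomials with moments
`L(z^n) = q^(-n(n+1)) ∑_{|i| ≤ n} (-q)^(i²)`. -/
noncomputable def momentFunctional (q : K) : K[X] →ₗ[K] K :=
  Polynomial.lsum fun n => LinearMap.toSpanSingleton K K (q⁻¹ ^ (n * (n + 1)) * thetaSum q n)

theorem momentFunctional_X_pow (q : K) (n : ℕ) :
    momentFunctional q (X ^ n) = q⁻¹ ^ (n * (n + 1)) * thetaSum q n := by
  rw [momentFunctional, lsum_apply, ← monomial_one_right_eq_X_pow, sum_monomial_index] <;> simp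

theorem momentFunctional_C_mul (q a : K) (f : K[X]) :
    momentFunctional q (C a * f) = a * momentFunctional q f := by
  rw [← smul_eq_C_mul, map_smul, smul_eq_mul]

/-- On the monomial `f = z^n` this is the relation
`thetaSum q (n + 1) = thetaSum q n + 2 (-q)^((n+1)²)`. -/
theorem momentFunctional_X_mul {q : K} (hq : q ≠ 0) (f : K[X]) :
    momentFunctional q (X * f) =
      q⁻¹ ^ 2 * momentFunctional q (dilate q⁻¹ f) - 2 * q⁻¹ * f.eval (-q⁻¹) := by
  induction f using Polynomial.induction_on' with
  | add f g hf hg =>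
    simp only [dilate, add_comp, mul_add, map_add, eval_add] at *
    rw [hf, hg]
    ring
  | monomial n a =>
    have h1 : X * monomial n a = C a * X ^ (n + 1) := by
      rw [← C_mul_X_pow_eq_monomial]; ring
    have h2 : dilate q⁻¹ (monomial n a) = C (a * (q⁻¹ ^ 2) ^ n) * X ^ n := by
      rw [dilate, monomial_comp, mul_pow, ← C_pow, C_mul, mul_assoc]
    rw [h1, h2, momentFunctional_C_mul, momentFunctional_C_mul, momentFunctional_X_pow,
      momentFunctional_X_pow, thetaSum_succ, eval_monomial]
    have h3 : (-q) ^ ((n + 1) ^ 2) = (-1) ^ (n + 1) * q ^ ((n + 1) ^ 2) := by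
      rw [neg_pow q, sq (n + 1), pow_mul (-1 : K)]
      rcases Nat.even_or_odd (n + 1) with h | h
      · rw [h.neg_one_pow, one_pow]
      · rw [h.neg_one_pow, h.neg_one_pow]
    have h4 : q⁻¹ ^ ((n + 1) ^ 2) * q ^ ((n + 1) ^ 2) = 1 := by
      rw [← mul_pow, inv_mul_cancel₀ hq, one_pow]
    rw [h3, neg_pow q⁻¹ n]
    linear_combination (2 * a * (-1) ^ (n + 1) * q⁻¹ ^ (n + 1)) * h4

/-- Apply `L` to the dilation identity of `P_{n+1}`, and replace `p² L(f(p² z))` by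
`L(z f(z)) + 2p f(-p)`. The two evaluations at `-p` cancel. -/
theorem momentFunctional_X_mul_denomPoly_succ {q : K} (hq : q ≠ 0) (n : ℕ) :
    momentFunctional q (X * denomPoly q⁻¹ (n + 1)) =
      (1 - q⁻¹ ^ (n + 1)) * (1 - q⁻¹ ^ (n + 3)) * momentFunctional q (X * denomPoly q⁻¹ n) +
        q⁻¹ ^ (n + 3) * momentFunctional q (denomPoly q⁻¹ (n + 1)) := by
  have h1 := momentFunctional_X_mul hq (denomPoly q⁻¹ (n + 1))
  have h2 := momentFunctional_X_mul hq (denomPoly q⁻¹ n)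
  rw [dilate_denomPoly, map_sub, map_add, mul_assoc, momentFunctional_C_mul,
    momentFunctional_C_mul, momentFunctional_C_mul, denomPoly_eval, qPoch_succ] at h1
  rw [denomPoly_eval] at h2
  linear_combination h1 - (1 - q⁻¹ ^ (n + 1)) * h2

/-- The recurrences for `L(P_n)` and `L(z P_n)` are solved simultaneously. The formula for `L(z P_n)`
is multiplied through by `1 - p²`, its denominator in closed form; this is where `q² ≠ 1` enters. -/
theorem momentFunctional_denomPoly_aux {q : K} (hq : q ≠ 0) (hq2 : q ^ 2 ≠ 1) (n : ℕ) :
    momentFunctional q (denomPoly q⁻¹ n) = qPoch q⁻¹ n ^ 2 ∧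
    momentFunctional q (denomPoly q⁻¹ (n + 1)) = qPoch q⁻¹ (n + 1) ^ 2 ∧
    (1 - q⁻¹ ^ 2) * momentFunctional q (X * denomPoly q⁻¹ n) =
      -(qPoch q⁻¹ n * qPoch q⁻¹ (n + 1) * (2 * q⁻¹ + q⁻¹ ^ 2 - q⁻¹ ^ (n + 3))) := by
  have hp : (1 - q⁻¹ ^ 2) ≠ 0 := by
    rw [sub_ne_zero, inv_pow, ne_comm, Ne, inv_eq_one]
    exact hq2
  have hX : momentFunctional q X = q⁻¹ ^ 2 - 2 * q⁻¹ := by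
    have h := momentFunctional_X_pow q 1
    rw [pow_one, thetaSum_succ, thetaSum_zero] at h
    rw [h]
    linear_combination (-2 * q⁻¹) * inv_mul_cancel₀ hq
  have h1 : momentFunctional q 1 = 1 := by
    have h := momentFunctional_X_pow q 0
    rwa [pow_zero, thetaSum_zero, zero_mul, pow_zero, mul_one] at h
  induction n with
  | zero =>
    simp only [denomPoly, map_add, h1, hX, mul_one, qPoch_zero, qPoch_succ]
    refine ⟨?_, ?_, ?_⟩ <;> ring
  | succ n ih =>
    obtain ⟨ih1, ih2, ih3⟩ := ih
    have hB : (1 - q⁻¹ ^ 2) * momentFunctional q (X * denomPoly q⁻¹ (n + 1)) =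
        -(qPoch q⁻¹ (n + 1) * qPoch q⁻¹ (n + 2) * (2 * q⁻¹ + q⁻¹ ^ 2 - q⁻¹ ^ (n + 4))) := by
      rw [momentFunctional_X_mul_denomPoly_succ hq, ih2, qPoch_succ _ (n + 1)]
      rw [qPoch_succ _ n] at ih3 ⊢
      linear_combination (1 - q⁻¹ ^ (n + 1)) * (1 - q⁻¹ ^ (n + 3)) * ih3
    refine ⟨ih2, mul_left_cancel₀ hp ?_, hB⟩
    have h4 : denomPoly q⁻¹ (n + 2) = denomPoly q⁻¹ (n + 1) + X * denomPoly q⁻¹ (n + 1) -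
      C ((1 - q⁻¹ ^ (n + 1)) ^ 2) * (X * denomPoly q⁻¹ n) := by
        simp only [denomPoly]; ring
    rw [h4, map_sub, map_add, momentFunctional_C_mul, ih2]
    rw [qPoch_succ _ (n + 1)] at hB ⊢
    rw [qPoch_succ _ n] at ih3 hB ⊢
    linear_combination hB - (1 - q⁻¹ ^ (n + 1)) ^ 2 * ih3

theorem momentFunctional_denomPoly {q : K} (hq : q ≠ 0) (hq2 : q ^ 2 ≠ 1) (n : ℕ) :
    momentFunctional q (denomPoly q⁻¹ n) = qPoch q⁻¹ n ^ 2 :=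
  (momentFunctional_denomPoly_aux hq hq2 n).1

theorem inv_pow_mul_qPoch_sq {q : K} (hq : q ≠ 0) (n : ℕ) :
    q⁻¹ ^ (n * (n + 1)) * qPoch q n ^ 2 = qPoch q⁻¹ n ^ 2 := by
  induction n with
  | zero => simp [qPoch_zero]
  | succ n ih =>
    rw [qPoch_succ, qPoch_succ, mul_pow (qPoch q⁻¹ n), ← ih]
    have h : q⁻¹ ^ (n + 1) * q ^ (n + 1) = 1 := by
      rw [← mul_pow, inv_mul_cancel₀ hq, one_pow]
    linear_combination (q⁻¹ ^ (n * (n + 1)) * qPoch q n ^ 2) *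
      (q⁻¹ ^ (n + 1) * q ^ (n + 1) + 1 - 2 * q⁻¹ ^ (n + 1)) * h

/-- The recurrence of `W` is that of lattice paths at height `h = a - b`, and it identifies
`(q; q)_h q^(-a(a+1)) W a b` with `L(z^b P_h)`. For `b = 0` this is the formula for `L(P_h)`; for
`h = 0` and `b = k` it is the claim. -/
theorem eq_thetaSum_of_recurrence {q : K} (hq : q ≠ 0) (hq2 : q ^ 2 ≠ 1) (W : ℕ → ℕ → K)
    (h00 : W 0 0 = 1) (h0 : ∀ a, W (a + 1) 0 = (1 - q ^ (a + 1)) * W a 0)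
    (hW : ∀ b h, W (b + h + 1) (b + 1) = q ^ (2 * (b + 1)) * (1 - q ^ h) * W (b + h) (b + 1) +
      (1 - q ^ (h + 1)) * W (b + h + 1) b - q ^ (2 * (b + h + 1)) * W (b + h) b) (k : ℕ) :
    W k k = thetaSum q k := by
  have hp : ∀ m, q⁻¹ ^ m * q ^ m = 1 := fun m => by
    rw [← mul_pow, inv_mul_cancel₀ hq, one_pow]
  have key : ∀ n h, qPoch q h * (q⁻¹ ^ ((n + h) * (n + h + 1)) * W (n + h) n) =
      momentFunctional q (X ^ n * denomPoly q⁻¹ h) := by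
    intro n
    induction n with
    | zero =>
      intro h
      have hW0 : W h 0 = qPoch q h := by
        induction h with
        | zero => rw [h00, qPoch_zero]
        | succ h ih => rw [h0, ih, qPoch_succ, mul_comm]
      rw [zero_add, hW0, pow_zero, one_mul, momentFunctional_denomPoly hq hq2,
        ← inv_pow_mul_qPoch_sq hq]
      ring
    | succ n ihn =>
      intro h
      induction h with
      -- At height `0` the coefficient `1 - q ^ 0` removes the first term of the recurrence.
      | zero =>
        have e1 := ihn 0
        have e2 := ihn 1
        have h1 : X ^ (n + 1) * denomPoly q⁻¹ 0 =
          X ^ n * denomPoly q⁻¹ 1 - X ^ n * denomPoly q⁻¹ 0 := by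
            simp only [denomPoly]; ring
        have h2 := hW n 0
        rw [h1, map_sub, ← e1, ← e2]
        simp only [add_zero, zero_add, pow_zero, sub_self, mul_zero, zero_mul, pow_one, qPoch_zero,
          qPoch_succ, one_mul] at h2 ⊢
        rw [h2]
        linear_combination (-q⁻¹ ^ (n * (n + 1)) * W n n) * hp (2 * (n + 1))
      | succ h ihh =>
        have e1 := ihn (h + 1)
        have e2 := ihn (h + 2)
        have h1 : X ^ (n + 1) * denomPoly q⁻¹ (h + 1) =
          X ^ n * denomPoly q⁻¹ (h + 2) - X ^ n * denomPoly q⁻¹ (h + 1) +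
            C ((1 - q⁻¹ ^ (h + 1)) ^ 2) * (X ^ (n + 1) * denomPoly q⁻¹ h) := by
            simp only [denomPoly]; ring
        have h2 := hW n (h + 1)
        rw [h1, map_add, map_sub, momentFunctional_C_mul, ← e1, ← e2, ← ihh]
        rw [show n + 1 + (h + 1) = n + (h + 1) + 1 by ring, h2,
          show n + 1 + h = n + (h + 1) by ring, show n + (h + 2) = n + (h + 1) + 1 by ring,
          qPoch_succ q (h + 1), qPoch_succ q h]
        linear_combination (qPoch q h * q⁻¹ ^ ((n + (h + 1)) * (n + (h + 1) + 1)) *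
            W (n + (h + 1)) (n + 1)) *
              (q⁻¹ ^ (2 * (h + 1)) * (1 - q ^ (h + 1)) ^ 2 * hp (2 * (n + 1)) +
                (q⁻¹ ^ (h + 1) * q ^ (h + 1) + 1 - 2 * q⁻¹ ^ (h + 1)) * hp (h + 1)) -
          (qPoch q h * (1 - q ^ (h + 1)) * q⁻¹ ^ ((n + (h + 1)) * (n + (h + 1) + 1)) *
            W (n + (h + 1)) n) * hp (2 * (n + (h + 1) + 1))
  have h := key k 0
  rw [denomPoly, mul_one, momentFunctional_X_pow, qPoch_zero, one_mul] at h
  exact mul_left_cancel₀ (pow_ne_zero _ (inv_ne_zero hq)) h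

end Field

/-! ### Removing and adding the first row of a shape -/

/-- Moves a cell one row down. -/
def shiftDown : ℕ × ℕ ↪ ℕ × ℕ :=
  ⟨fun c => (c.1 + 1, c.2), fun a b h => by simpa [Prod.ext_iff] using h⟩

theorem shiftDown_apply (c : ℕ × ℕ) : shiftDown c = (c.1 + 1, c.2) := rfl

/-- The diagram with its first row removed. -/
noncomputable def tailShape (lam : YoungDiagram) : YoungDiagram where
  cells := lam.cells.preimage shiftDown shiftDown.injective.injOn
  isLowerSet := by
    intro a b hba ha
    rw [Finset.mem_coe, Finset.mem_preimage, shiftDown_apply, YoungDiagram.mem_cells] at ha ⊢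
    exact lam.up_left_mem (Nat.succ_le_succ hba.1) hba.2 ha

theorem mem_tailShape {lam : YoungDiagram} {i j : ℕ} :
    (i, j) ∈ tailShape lam ↔ (i + 1, j) ∈ lam := by
  rw [← YoungDiagram.mem_cells, tailShape, Finset.mem_preimage, shiftDown_apply,
    YoungDiagram.mem_cells]

theorem rowLen_tailShape (lam : YoungDiagram) (i : ℕ) :
    (tailShape lam).rowLen i = lam.rowLen (i + 1) :=
  eq_of_forall_lt_iff fun j => by
    rw [← YoungDiagram.mem_iff_lt_rowLen, mem_tailShape, YoungDiagram.mem_iff_lt_rowLen]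

theorem colLen_tailShape (lam : YoungDiagram) (j : ℕ) :
    (tailShape lam).colLen j = lam.colLen j - 1 :=
  eq_of_forall_lt_iff fun i => by
    rw [← YoungDiagram.mem_iff_lt_colLen, mem_tailShape, YoungDiagram.mem_iff_lt_colLen]
    omega

/-- The diagram `mu` with a new first row of length `b` put on top. -/
def consShape (b : ℕ) (mu : YoungDiagram) (h : mu.rowLen 0 ≤ b) : YoungDiagram where
  cells := ({0} ×ˢ Finset.range b) ∪
    mu.cells.map shiftDown
  isLowerSet := by
    rintro ⟨i, j⟩ ⟨i', j'⟩ ⟨hi, hj⟩ ha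
    simp only [Finset.coe_union, Set.mem_union, Finset.mem_coe, Finset.mem_product,
      Finset.mem_singleton, Finset.mem_range, Finset.mem_map, shiftDown_apply,
      YoungDiagram.mem_cells, Prod.exists, Prod.mk.injEq] at ha hi hj ⊢
    rcases ha with ⟨rfl, ha⟩ | ⟨x, y, hxy, rfl, rfl⟩
    · left; omega
    · rcases i' with _ | i'
      · left
        have := YoungDiagram.mem_iff_lt_rowLen.1 hxy
        have := mu.rowLen_anti 0 x (Nat.zero_le _)
        omega
      · exact Or.inr ⟨i', j', mu.up_left_mem (by omega) hj hxy, rfl, rfl⟩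

theorem mem_consShape_zero {b : ℕ} {mu : YoungDiagram} {h : mu.rowLen 0 ≤ b} {j : ℕ} :
    (0, j) ∈ consShape b mu h ↔ j < b := by
  rw [← YoungDiagram.mem_cells, consShape]
  simp [shiftDown_apply]

theorem mem_consShape_succ {b : ℕ} {mu : YoungDiagram} {h : mu.rowLen 0 ≤ b} {i j : ℕ} :
    (i + 1, j) ∈ consShape b mu h ↔ (i, j) ∈ mu := by
  rw [← YoungDiagram.mem_cells, consShape]
  simp [shiftDown_apply]

theorem card_consShape {b : ℕ} {mu : YoungDiagram} {h : mu.rowLen 0 ≤ b} :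
    (consShape b mu h).card = b + mu.card := by
  rw [YoungDiagram.card, consShape, Finset.card_union_of_disjoint, Finset.card_map,
    Finset.card_product, Finset.card_singleton, Finset.card_range, one_mul]
  rw [Finset.disjoint_left]
  rintro ⟨i, j⟩ h1 h2
  simp only [Finset.mem_product, Finset.mem_singleton, Finset.mem_range, Finset.mem_map,
    shiftDown_apply, Prod.exists, Prod.mk.injEq] at h1 h2
  obtain ⟨x, y, -, h3, -⟩ := h2
  omega

theorem rowLen_zero_consShape {b : ℕ} {mu : YoungDiagram} {h : mu.rowLen 0 ≤ b} :
    (consShape b mu h).rowLen 0 = b :=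
  eq_of_forall_lt_iff fun j => by
    rw [← YoungDiagram.mem_iff_lt_rowLen, mem_consShape_zero]

theorem tailShape_consShape {b : ℕ} {mu : YoungDiagram} {h : mu.rowLen 0 ≤ b} :
    tailShape (consShape b mu h) = mu :=
  SetLike.ext fun ⟨i, j⟩ => by rw [mem_tailShape, mem_consShape_succ]

theorem rowLen_zero_tailShape_le (lam : YoungDiagram) :
    (tailShape lam).rowLen 0 ≤ lam.rowLen 0 := by
  rw [rowLen_tailShape]
  exact lam.rowLen_anti _ _ (Nat.zero_le _)

theorem consShape_tailShape (lam : YoungDiagram) :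
    consShape (lam.rowLen 0) (tailShape lam) (rowLen_zero_tailShape_le lam) = lam :=
  SetLike.ext fun ⟨i, j⟩ => by
    rcases i with _ | i
    · rw [mem_consShape_zero, YoungDiagram.mem_iff_lt_rowLen]
    · rw [mem_consShape_succ, mem_tailShape]

theorem le_staircase_iff {lam : YoungDiagram} {a : ℕ} :
    lam ≤ staircase a ↔ ∀ i, lam.rowLen i ≤ a - i := by
  constructor
  · intro h i
    rw [← rowLen_staircase]
    by_contra! hlt
    exact lt_irrefl _ (YoungDiagram.mem_iff_lt_rowLen.1 (h (YoungDiagram.mem_iff_lt_rowLen.2 hlt)))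
  · rintro h ⟨i, j⟩ hc
    have := YoungDiagram.mem_iff_lt_rowLen.1 hc
    have := h i
    rw [mem_staircase]
    simp only
    omega

theorem finite_shapes (a b : ℕ) :
    {lam : YoungDiagram | lam ≤ staircase (a - 1) ∧ lam.rowLen 0 ≤ b}.Finite := by
  refine Set.Finite.subset (Set.Finite.preimage (f := YoungDiagram.cells)
    (fun _ _ _ _ h => YoungDiagram.ext h)
    (Finset.finite_toSet (staircase (a - 1)).cells.powerset)) fun lam h => ?_
  simpa using YoungDiagram.cells_subset_iff.2 h.1

/-- The partitions contained in `δ_{a-1}` that have at most `b` columns. -/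
noncomputable def shapes (a b : ℕ) : Finset YoungDiagram := (finite_shapes a b).toFinset

theorem mem_shapes {a b : ℕ} {lam : YoungDiagram} :
    lam ∈ shapes a b ↔ lam ≤ staircase (a - 1) ∧ lam.rowLen 0 ≤ b := by
  simp [shapes]

theorem shapes_zero_right (a : ℕ) : shapes a 0 = {⊥} := by
  ext lam
  rw [mem_shapes, Finset.mem_singleton]
  constructor
  · rintro ⟨-, h⟩
    rw [eq_bot_iff]
    rintro ⟨i, j⟩ hc
    have := YoungDiagram.mem_iff_lt_rowLen.1 hc
    have := lam.rowLen_anti 0 i (Nat.zero_le _)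
    omega
  · rintro rfl
    refine ⟨bot_le, le_of_eq ?_⟩
    rw [YoungDiagram.rowLen_eq_card]
    simp [YoungDiagram.row]

variable {R : Type*} [CommRing R]

/-- Removing the first row is a bijection from the shapes in `δ_a` whose first row has length `b` to
the shapes in `δ_{a-1}` with at most `b` columns. -/
theorem sum_shapes_rowLen_eq {a b : ℕ} (hb : b ≤ a) (f : YoungDiagram → R) (g : YoungDiagram → R)
    (hfg : ∀ lam, lam.rowLen 0 = b → lam ≤ staircase a → f lam = g (tailShape lam)) :
    ∑ lam ∈ (shapes (a + 1) b).filter (fun lam => lam.rowLen 0 = b), f lam =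
      ∑ mu ∈ shapes a b, g mu := by
  refine Finset.sum_bij' (fun lam _ => tailShape lam)
    (fun mu h => consShape b mu (mem_shapes.1 h).2) ?_ ?_ ?_ ?_ ?_
  · intro lam h
    rw [Finset.mem_filter, mem_shapes, Nat.add_sub_cancel, le_staircase_iff] at h
    rw [mem_shapes, le_staircase_iff]
    refine ⟨fun i => ?_, h.2 ▸ rowLen_zero_tailShape_le lam⟩
    have := h.1.1 (i + 1)
    rw [rowLen_tailShape]
    omega
  · intro mu h
    have h' := (mem_shapes.1 h).1
    rw [Finset.mem_filter, mem_shapes, Nat.add_sub_cancel, rowLen_zero_consShape,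
      le_staircase_iff]
    rw [le_staircase_iff] at h'
    refine ⟨⟨fun i => ?_, le_rfl⟩, rfl⟩
    rcases i with _ | i
    · rw [rowLen_zero_consShape]
      omega
    · rw [← rowLen_tailShape, tailShape_consShape]
      have := h' i
      omega
  · intro lam h
    have h' := (Finset.mem_filter.1 h).2
    subst h'
    exact consShape_tailShape lam
  · intro mu h
    exact tailShape_consShape
  · intro lam h
    rw [Finset.mem_filter, mem_shapes, Nat.add_sub_cancel] at h
    exact hfg lam h.2 h.1.1

theorem card_eq_rowLen_add_tailShape (lam : YoungDiagram) :
    lam.card = lam.rowLen 0 + (tailShape lam).card := by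
  conv_lhs => rw [← consShape_tailShape lam]
  exact card_consShape

/-! ### The sum over the arrows on a fixed shape -/

/-- The contribution of row `i` of `δ_a / lam` once the set `C` of columns with a vertical arrow is
fixed: `1 - q^length`, or `1` if a horizontal arrow is forbidden, which happens if the first cell
`(i, lam.rowLen i)` of the row is an outer corner in a column of `C`. -/
def rowFactor (q : R) (a : ℕ) (lam : YoungDiagram) (C : Finset ℕ) (i : ℕ) : R :=
  if lam.colLen (lam.rowLen i) = i ∧ lam.rowLen i ∈ C then 1 else 1 - q ^ (a - i - lam.rowLen i)

/-- The weight of the vertical arrows in the columns of `C`. -/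
def colWeight (q : R) (a : ℕ) (lam : YoungDiagram) (C : Finset ℕ) : R :=
  ∏ j ∈ C, -q ^ (a - j - lam.colLen j)

/-- The signed sum over all admissible sets of arrows in the first `a` rows and the first `b` columns
of `δ_a / lam`; the horizontal arrows are already summed out in `rowFactor`. -/
def arrowSum (q : R) (a b : ℕ) (lam : YoungDiagram) : R :=
  ∑ C ∈ (Finset.range b).powerset, colWeight q a lam C * ∏ i ∈ Finset.range a,
    rowFactor q a lam C i

/-- The generating function of the configurations with `a` rows and `b` columns. -/
noncomputable def partialSum (q : R) (a b : ℕ) : R :=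
  ∑ lam ∈ shapes a b, q ^ (2 * lam.card) * arrowSum q a b lam

theorem colLen_eq_zero_iff {lam : YoungDiagram} {j : ℕ} : lam.colLen j = 0 ↔ lam.rowLen 0 ≤ j := by
  rw [← Nat.not_lt, ← YoungDiagram.mem_iff_lt_rowLen, YoungDiagram.mem_iff_lt_colLen]
  omega

/-- Removing a first row that covers all the columns in play changes no length and no outer corner
in the remaining rows. -/
theorem arrowSum_tailShape_aux (q : R) {a b : ℕ} {lam : YoungDiagram} (h : lam.rowLen 0 = b)
    {C : Finset ℕ} (hC : ∀ j ∈ C, j < b) :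
    colWeight q (a + 1) lam C = colWeight q a (tailShape lam) C ∧
    ∀ i, rowFactor q (a + 1) lam C (i + 1) = rowFactor q a (tailShape lam) C i := by
  have hcol : ∀ j, j < b → lam.colLen j ≠ 0 := fun j hj => by
    rw [Ne, colLen_eq_zero_iff]
    omega
  constructor
  · refine Finset.prod_congr rfl fun j hj => ?_
    have := hcol j (hC j hj)
    rw [colLen_tailShape]
    congr 2
    omega
  · intro i
    rw [rowFactor, rowFactor, rowLen_tailShape, colLen_tailShape]
    refine if_congr ?_ rfl ?_
    · refine and_congr_left fun hm => ?_
      have := hcol _ (hC _ hm)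
      omega
    · congr 2
      omega

theorem arrowSum_of_rowLen_eq (q : R) {a b : ℕ} {lam : YoungDiagram} (h : lam.rowLen 0 = b) :
    arrowSum q (a + 1) b lam = (1 - q ^ (a + 1 - b)) * arrowSum q a b (tailShape lam) := by
  rw [arrowSum, arrowSum, Finset.mul_sum]
  refine Finset.sum_congr rfl fun C hC => ?_
  have hC' : ∀ j ∈ C, j < b := fun j hj => Finset.mem_range.1 (Finset.mem_powerset.1 hC hj)
  obtain ⟨h1, h2⟩ := arrowSum_tailShape_aux q (a := a) h hC'
  rw [Finset.prod_range_succ', h1, Finset.prod_congr rfl fun i _ => h2 i, rowFactor, if_neg, h]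
  · rw [Nat.sub_zero]
    ring
  · rintro ⟨-, hm⟩
    have := hC' _ hm
    omega

/-- If column `b` of the shape is empty, it may carry an arrow of length `a + 1 - b` or not. The
correction removes the pairs of arrows meeting in the outer corner `(0, b)`. -/
theorem arrowSum_succ (q : R) {a b : ℕ} {lam : YoungDiagram} (h : lam.rowLen 0 ≤ b) :
    arrowSum q (a + 1) (b + 1) lam = (1 - q ^ (a + 1 - b)) * arrowSum q (a + 1) b lam -
      if lam.rowLen 0 = b then q ^ (2 * (a + 1 - b)) * arrowSum q a b (tailShape lam) else 0 := by
  have hb : ∀ C ∈ (Finset.range b).powerset, b ∉ C := fun C hC hm => by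
    have := Finset.mem_range.1 (Finset.mem_powerset.1 hC hm)
    omega
  have hc0 : lam.colLen b = 0 := colLen_eq_zero_iff.2 h
  have hcw : ∀ C ∈ (Finset.range b).powerset, colWeight q (a + 1) lam (insert b C) =
      -q ^ (a + 1 - b) * colWeight q (a + 1) lam C := fun C hC => by
    rw [colWeight, Finset.prod_insert (hb C hC), hc0, Nat.sub_zero, colWeight]
  have hrow : ∀ C ∈ (Finset.range b).powerset, ∀ i, (i ≠ 0 ∨ lam.rowLen 0 ≠ b) →
      rowFactor q (a + 1) lam (insert b C) i = rowFactor q (a + 1) lam C i := fun C hC i hi => by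
    refine if_congr (and_congr_right fun hi' => ?_) rfl rfl
    rw [Finset.mem_insert, or_iff_right]
    intro h'
    rw [h', hc0] at hi'
    subst hi'
    exact hi.elim (fun h => h rfl) fun h => h h'
  rw [arrowSum, Finset.range_add_one (n := b), Finset.sum_powerset_insert (by simp), ← arrowSum]
  split_ifs with h0
  -- `(0, b)` is an outer corner: an arrow in column `b` excludes the one in row `0`.
  · have h1 : ∑ C ∈ (Finset.range b).powerset, colWeight q (a + 1) lam (insert b C) *
        ∏ i ∈ Finset.range (a + 1), rowFactor q (a + 1) lam (insert b C) i =
        -q ^ (a + 1 - b) * arrowSum q a b (tailShape lam) := by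
      rw [arrowSum, Finset.mul_sum]
      refine Finset.sum_congr rfl fun C hC => ?_
      obtain ⟨h1, h2⟩ := arrowSum_tailShape_aux q (a := a) h0 (C := C)
        fun j hj => Finset.mem_range.1 (Finset.mem_powerset.1 hC hj)
      rw [Finset.prod_range_succ', hcw C hC, h1,
        Finset.prod_congr rfl fun i _ => (hrow C hC (i + 1) (Or.inl (Nat.succ_ne_zero i))).trans
          (h2 i), rowFactor, if_pos, mul_one]
      · ring
      · rw [h0]
        exact ⟨hc0, Finset.mem_insert_self _ _⟩
    rw [h1, arrowSum_of_rowLen_eq q h0]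
    ring
  · have h1 : ∑ C ∈ (Finset.range b).powerset, colWeight q (a + 1) lam (insert b C) *
        ∏ i ∈ Finset.range (a + 1), rowFactor q (a + 1) lam (insert b C) i =
        -q ^ (a + 1 - b) * arrowSum q (a + 1) b lam := by
      rw [arrowSum, Finset.mul_sum]
      refine Finset.sum_congr rfl fun C hC => ?_
      rw [hcw C hC,
        Finset.prod_congr rfl fun i _ => hrow C hC i (Or.inr h0), mul_assoc]
    rw [h1]
    ring

/-! ### The recurrence for the partial sums -/

theorem partialSum_zero_zero (q : R) : partialSum q 0 0 = 1 := by
  simp [partialSum, shapes_zero_right, arrowSum, colWeight, YoungDiagram.card]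

theorem partialSum_succ_zero (q : R) (a : ℕ) :
    partialSum q (a + 1) 0 = (1 - q ^ (a + 1)) * partialSum q a 0 := by
  have h0 : (⊥ : YoungDiagram).rowLen 0 = 0 :=
    Nat.le_zero.1 (mem_shapes.1 ((shapes_zero_right 0).symm ▸ Finset.mem_singleton_self _)).2
  have h1 : tailShape ⊥ = ⊥ := SetLike.ext fun ⟨i, j⟩ => by
    rw [mem_tailShape]
    simp
  rw [partialSum, partialSum, shapes_zero_right, shapes_zero_right, Finset.sum_singleton,
    Finset.sum_singleton, arrowSum_of_rowLen_eq q h0, h1, Nat.sub_zero]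
  ring

theorem sum_shapes_full (q : R) {a b : ℕ} (hb : b ≤ a) (c : R) (f : YoungDiagram → R)
    (hf : ∀ lam, lam.rowLen 0 = b → f lam = c * arrowSum q a b (tailShape lam)) :
    ∑ lam ∈ (shapes (a + 1) b).filter (fun lam => lam.rowLen 0 = b),
      q ^ (2 * lam.card) * f lam = q ^ (2 * b) * c * partialSum q a b := by
  rw [partialSum, Finset.mul_sum]
  refine sum_shapes_rowLen_eq hb _
    (fun mu => q ^ (2 * b) * c * (q ^ (2 * mu.card) * arrowSum q a b mu)) fun lam h _ => ?_
  rw [hf lam h, card_eq_rowLen_add_tailShape, h]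
  ring

/-- The three terms come from the shapes whose first row has length `b + 1`, from those with at most
`b` columns, and from the outer corner `(0, b)`. -/
theorem partialSum_succ_succ (q : R) {a b : ℕ} (hb : b ≤ a) :
    partialSum q (a + 1) (b + 1) =
      q ^ (2 * (b + 1)) * (1 - q ^ (a - b)) * partialSum q a (b + 1) +
        (1 - q ^ (a + 1 - b)) * partialSum q (a + 1) b -
        q ^ (2 * (a + 1)) * partialSum q a b := by
  rw [partialSum, ← Finset.sum_filter_add_sum_filter_not _ (fun lam => lam.rowLen 0 = b + 1),
    add_sub_assoc]
  congr 1
  · rcases hb.lt_or_eq with hlt | rfl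
    · refine sum_shapes_full q hlt _ _ fun lam h => ?_
      rw [arrowSum_of_rowLen_eq q h, Nat.add_sub_add_right]
    -- For `b = a` no first row of length `a + 1` fits into `δ_a`, and the coefficient vanishes.
    · rw [Nat.sub_self, pow_zero, sub_self, mul_zero, zero_mul]
      refine Finset.sum_eq_zero fun lam h => ?_
      rw [Finset.mem_filter, mem_shapes, le_staircase_iff] at h
      have := h.1.1 0
      omega
  · have h1 : (shapes (a + 1) (b + 1)).filter (fun lam => ¬ lam.rowLen 0 = b + 1) =
        shapes (a + 1) b := by
      ext lam
      rw [Finset.mem_filter, mem_shapes, mem_shapes, and_assoc]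
      refine and_congr_right fun _ => ?_
      omega
    have h2 := sum_shapes_full q hb (q ^ (2 * (a + 1 - b)))
      (fun lam => q ^ (2 * (a + 1 - b)) * arrowSum q a b (tailShape lam)) fun lam _ => rfl
    rw [← pow_add, ← mul_add, Nat.add_sub_cancel' (by omega)] at h2
    rw [h1, ← h2, partialSum, Finset.mul_sum, Finset.sum_filter, ← Finset.sum_sub_distrib]
    refine Finset.sum_congr rfl fun lam h => ?_
    rw [arrowSum_succ q (mem_shapes.1 h).2]
    split_ifs <;> ring


/-! ### Configurations in coordinates -/

theorem mem_skewCells {k : ℕ} {lam : YoungDiagram} {i j : ℕ} :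
    (i, j) ∈ skewCells k lam ↔ i + j < k ∧ (i, j) ∉ lam := by
  rw [skewCells, Finset.mem_sdiff, YoungDiagram.mem_cells, YoungDiagram.mem_cells, mem_staircase]

theorem length_inl {k : ℕ} (lam : YoungDiagram) (i : Fin k) :
    Arrow.length lam (Sum.inl i : Arrow k) = k - i - lam.rowLen i := by
  have h : Arrow.cells lam (Sum.inl i : Arrow k) =
      {(i : ℕ)} ×ˢ Finset.Ico (lam.rowLen i) (k - i) := by
    ext ⟨x, y⟩
    rw [Arrow.cells, Finset.mem_filter, mem_skewCells, YoungDiagram.mem_iff_lt_rowLen,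
      Finset.mem_product, Finset.mem_singleton, Finset.mem_Ico]
    constructor
    · rintro ⟨h, rfl⟩
      exact ⟨rfl, by omega⟩
    · rintro ⟨rfl, h⟩
      exact ⟨by omega, rfl⟩
  rw [Arrow.length, h, Finset.card_product, Finset.card_singleton, one_mul, Nat.card_Ico]

theorem length_inr {k : ℕ} (lam : YoungDiagram) (j : Fin k) :
    Arrow.length lam (Sum.inr j : Arrow k) = k - j - lam.colLen j := by
  have h : Arrow.cells lam (Sum.inr j : Arrow k) =
      Finset.Ico (lam.colLen j) (k - j) ×ˢ {(j : ℕ)} := by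
    ext ⟨x, y⟩
    rw [Arrow.cells, Finset.mem_filter, mem_skewCells, YoungDiagram.mem_iff_lt_colLen,
      Finset.mem_product, Finset.mem_singleton, Finset.mem_Ico]
    constructor
    · rintro ⟨h, rfl⟩
      exact ⟨by omega, rfl⟩
    · rintro ⟨h, rfl⟩
      exact ⟨by omega, rfl⟩
  rw [Arrow.length, h, Finset.card_product, Finset.card_singleton, mul_one, Nat.card_Ico]

theorem isOuterCorner_iff {k : ℕ} {lam : YoungDiagram} {i j : ℕ} :
    IsOuterCorner k lam (i, j) ↔ i + j < k ∧ lam.rowLen i = j ∧ lam.colLen j = i := by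
  rw [IsOuterCorner, mem_skewCells]
  constructor
  · rintro ⟨⟨hk, hc⟩, hl⟩
    have h1 : ¬ j < lam.rowLen i := fun h => hc (YoungDiagram.mem_iff_lt_rowLen.2 h)
    have h2 : ¬ i < lam.colLen j := fun h => hc (YoungDiagram.mem_iff_lt_colLen.2 h)
    -- Every cell weakly above and to the left of the corner, other than the corner, is in `lam`.
    have hmem : ∀ x y, x ≤ i → y ≤ j → (x, y) ≠ (i, j) → (x, y) ∈ lam := fun x y hx hy hne => by
      have h := hl (show (x, y) ≤ (i, j) from ⟨hx, hy⟩) (by simp)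
      rw [Finset.mem_coe, Finset.mem_insert, YoungDiagram.mem_cells] at h
      exact h.resolve_left hne
    refine ⟨hk, ?_, ?_⟩
    · by_contra hne
      have := YoungDiagram.mem_iff_lt_rowLen.1 (hmem i (j - 1) le_rfl (by omega) fun h => by
        rw [Prod.mk.injEq] at h
        omega)
      omega
    · by_contra hne
      have := YoungDiagram.mem_iff_lt_colLen.1 (hmem (i - 1) j (by omega) le_rfl fun h => by
        rw [Prod.mk.injEq] at h
        omega)
      omega
  · rintro ⟨hk, hr, hc⟩
    refine ⟨⟨hk, ?_⟩, ?_⟩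
    · rw [YoungDiagram.mem_iff_lt_rowLen]
      omega
    · rintro ⟨a, b⟩ ⟨x, y⟩ ⟨hx, hy⟩ h
      rw [Finset.mem_coe, Finset.mem_insert, YoungDiagram.mem_cells] at h ⊢
      rcases h with h | h
      · rw [Prod.mk.injEq] at h
        obtain ⟨rfl, rfl⟩ := h
        rcases lt_or_eq_of_le (show x ≤ a from hx) with h | rfl
        · exact Or.inr (lam.up_left_mem le_rfl hy
            (YoungDiagram.mem_iff_lt_colLen.2 (h.trans_eq hc.symm)))
        · rcases lt_or_eq_of_le (show y ≤ b from hy) with h | rfl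
          · exact Or.inr (YoungDiagram.mem_iff_lt_rowLen.2 (h.trans_eq hr.symm))
          · exact Or.inl rfl
      · exact Or.inr (lam.up_left_mem hx hy h)

/-- No outer corner of `δ_k / lam` lies both in a row of `A` and in a column of `B`. -/
def Compatible (k : ℕ) (lam : YoungDiagram) (A B : Finset (Fin k)) : Prop :=
  ∀ i ∈ A, ∀ j ∈ B, ¬ (lam.rowLen i = j ∧ lam.colLen j = i)

theorem no_forbidden_corner_iff {k : ℕ} {lam : YoungDiagram} (h : lam ≤ staircase (k - 1))
    (s : Finset (Arrow k)) :
    (∀ c, IsOuterCorner k lam c → ∀ u ∈ s, ∀ v ∈ s,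
      c ∈ Arrow.cells lam u → c ∈ Arrow.cells lam v → u = v) ↔
    Compatible k lam s.toLeft s.toRight := by
  constructor
  · rintro H i hi j hj ⟨hr, hc⟩
    have hk : (i : ℕ) + j < k := by
      have := le_staircase_iff.1 h i
      omega
    have hcor := isOuterCorner_iff.2 ⟨hk, hr, hc⟩
    have := H _ hcor (Sum.inl i) (Finset.mem_toLeft.1 hi) (Sum.inr j) (Finset.mem_toRight.1 hj)
      (Finset.mem_filter.2 ⟨hcor.1, rfl⟩) (Finset.mem_filter.2 ⟨hcor.1, rfl⟩)
    simp at this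
  · rintro H ⟨x, y⟩ hcor u hu v hv hcu hcv
    obtain ⟨-, hr, hc⟩ := isOuterCorner_iff.1 hcor
    have key : ∀ i j : Fin k, Sum.inl i ∈ s → Sum.inr j ∈ s → (x, y) ∈ Arrow.cells lam (Sum.inl i) →
        (x, y) ∈ Arrow.cells lam (Sum.inr j) → False := by
      intro i j hi hj h1 h2
      have h1 : x = i := (Finset.mem_filter.1 h1).2
      have h2 : y = j := (Finset.mem_filter.1 h2).2
      exact H i (Finset.mem_toLeft.2 hi) j (Finset.mem_toRight.2 hj)
        ⟨by rw [← h1, ← h2, hr], by rw [← h1, ← h2, hc]⟩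
    rcases u with i | i <;> rcases v with j | j
    · have h1 : x = i := (Finset.mem_filter.1 hcu).2
      have h2 : x = j := (Finset.mem_filter.1 hcv).2
      rw [Fin.ext (h1.symm.trans h2)]
    · exact (key i j hu hv hcu hcv).elim
    · exact (key j i hv hu hcv hcu).elim
    · have h1 : y = i := (Finset.mem_filter.1 hcu).2
      have h2 : y = j := (Finset.mem_filter.1 hcv).2
      rw [Fin.ext (h1.symm.trans h2)]

theorem qWeight_eq_prod {k : ℕ} (q : R) (C : DeltaPlus k) :
    C.qWeight q = q ^ (2 * C.shape.card) *
      ((∏ i ∈ C.arrows.toLeft, -q ^ (k - i - C.shape.rowLen i)) *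
        ∏ j ∈ C.arrows.toRight, -q ^ (k - j - C.shape.colLen j)) := by
  have h : ∏ u ∈ C.arrows, -q ^ Arrow.length C.shape u =
      (-1) ^ C.arrows.card * q ^ C.arrowNorm := by
    rw [DeltaPlus.arrowNorm, ← Finset.prod_pow_eq_pow_sum, Finset.prod_neg]
  rw [Finset.prod_sum_eq_prod_toLeft_mul_prod_toRight] at h
  simp only [length_inl, length_inr] at h
  rw [h, DeltaPlus.qWeight, pow_add]
  ring

open Classical in
/-- For fixed vertical arrows the horizontal ones are chosen independently, row by row. -/
theorem sum_compatible (q : R) (k : ℕ) (lam : YoungDiagram) (B : Finset (Fin k)) :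
    (∑ A : Finset (Fin k), if Compatible k lam A B then
      ∏ i ∈ A, -q ^ (k - i - lam.rowLen i) else 0) =
    ∏ i ∈ Finset.range k, rowFactor q k lam (B.map Fin.valEmbedding) i := by
  set ok : Finset (Fin k) := Finset.univ.filter fun i =>
    ∀ j ∈ B, ¬ (lam.rowLen i = j ∧ lam.colLen j = i) with hok
  have h1 : ∀ A, Compatible k lam A B ↔ A ∈ ok.powerset := fun A => by
    rw [Finset.mem_powerset, Finset.subset_iff, Compatible]
    simp [hok]
  simp only [h1]
  rw [← Finset.sum_filter, Finset.filter_univ_mem, ← Finset.prod_one_add, hok, Finset.prod_filter,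
    ← Fin.prod_univ_eq_prod_range]
  refine Finset.prod_congr rfl fun i _ => ?_
  have h2 : (∀ j ∈ B, ¬ (lam.rowLen i = j ∧ lam.colLen j = i)) ↔
      ¬ (lam.colLen (lam.rowLen i) = i ∧ lam.rowLen i ∈ B.map Fin.valEmbedding) := by
    rw [← not_iff_not, not_not]
    push Not
    constructor
    · rintro ⟨j, hj, h3, h4⟩
      rw [h3]
      exact ⟨h4, Finset.mem_map_of_mem _ hj⟩
    · rintro ⟨h3, h4⟩
      obtain ⟨j, hj, h5⟩ := Finset.mem_map.1 h4
      have h5 : (j : ℕ) = lam.rowLen i := h5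
      exact ⟨j, hj, h5.symm, h5 ▸ h3⟩
  rw [if_congr h2 rfl rfl, ite_not, rowFactor, sub_eq_add_neg]

theorem sum_finset_fin (k : ℕ) (f : Finset ℕ → R) :
    ∑ B : Finset (Fin k), f (B.map Fin.valEmbedding) = ∑ C ∈ (Finset.range k).powerset, f C := by
  refine Finset.sum_bij (fun B _ => B.map Fin.valEmbedding) ?_ ?_ ?_ fun _ _ => rfl
  · intro B _
    rw [Finset.mem_powerset]
    intro x hx
    obtain ⟨j, -, rfl⟩ := Finset.mem_map.1 hx
    exact Finset.mem_range.2 j.2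
  · intro B _ B' _ h
    exact Finset.map_injective _ h
  · intro C hC
    refine ⟨Finset.univ.filter fun j : Fin k => (j : ℕ) ∈ C, Finset.mem_univ _, ?_⟩
    ext x
    simp only [Finset.mem_map, Finset.mem_filter, Finset.mem_univ, true_and, Fin.valEmbedding_apply]
    constructor
    · rintro ⟨j, hj, rfl⟩
      exact hj
    · intro hx
      exact ⟨⟨x, Finset.mem_range.1 (Finset.mem_powerset.1 hC hx)⟩, hx, rfl⟩

open Classical in
theorem sum_qWeight_eq_partialSum (q : R) (k : ℕ) :
    ∑ C : DeltaPlus k, C.qWeight q = partialSum q k k := by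
  have h1 : ∑ C : DeltaPlus k, C.qWeight q = ∑ x ∈ (shapes k k).sigma
      (fun lam => Finset.univ.filter fun s : Finset (Arrow k) =>
        Compatible k lam s.toLeft s.toRight),
      q ^ (2 * x.1.card) * ((∏ i ∈ x.2.toLeft, -q ^ (k - i - x.1.rowLen i)) *
        ∏ j ∈ x.2.toRight, -q ^ (k - j - x.1.colLen j)) := by
    refine Finset.sum_bij (fun C _ => ⟨C.shape, C.arrows⟩) ?_ ?_ ?_
      fun C _ => qWeight_eq_prod q C
    · intro C _
      rw [Finset.mem_sigma, mem_shapes, Finset.mem_filter]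
      refine ⟨⟨C.shape_le, ?_⟩, Finset.mem_univ _,
        (no_forbidden_corner_iff C.shape_le _).1 C.no_forbidden_corner⟩
      have := le_staircase_iff.1 C.shape_le 0
      simp only
      omega
    · intro C _ D _ h
      rw [Sigma.mk.injEq] at h
      exact DeltaPlus.ext h.1 (eq_of_heq h.2)
    · rintro ⟨lam, s⟩ h
      rw [Finset.mem_sigma, mem_shapes, Finset.mem_filter] at h
      exact ⟨⟨lam, s, h.1.1, (no_forbidden_corner_iff h.1.1 s).2 h.2.2⟩, Finset.mem_univ _, rfl⟩
  rw [h1, Finset.sum_sigma, partialSum]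
  refine Finset.sum_congr rfl fun lam _ => ?_
  dsimp only
  rw [← Finset.mul_sum]
  congr 1
  rw [arrowSum, ← sum_finset_fin, Finset.sum_filter,
    ← Finset.sumEquiv.symm.toEquiv.sum_comp, Fintype.sum_prod_type_right]
  refine Finset.sum_congr rfl fun B _ => ?_
  rw [← sum_compatible, Finset.mul_sum, colWeight, Finset.prod_map]
  refine Finset.sum_congr rfl fun A _ => ?_
  simp only [OrderIso.coe_toEquiv, Finset.sumEquiv_symm_apply, Finset.toLeft_disjSum,
    Finset.toRight_disjSum, Fin.valEmbedding_apply, mul_ite, mul_zero]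
  rw [mul_comm]

/-! ### Evaluation and specialization -/

theorem sum_qWeight_of_field {K : Type*} [Field K] {q : K} (hq : q ≠ 0) (hq2 : q ^ 2 ≠ 1) (k : ℕ) :
    ∑ C : DeltaPlus k, C.qWeight q = thetaSum q k := by
  rw [sum_qWeight_eq_partialSum]
  refine eq_thetaSum_of_recurrence hq hq2 (partialSum q) (partialSum_zero_zero q)
    (partialSum_succ_zero q) (fun b h => ?_) k
  rw [partialSum_succ_succ q (Nat.le_add_right b h), Nat.add_sub_cancel_left, add_assoc b h 1,
    Nat.add_sub_cancel_left]

theorem map_qWeight {S : Type*} [CommRing S] (φ : R →+* S) {k : ℕ} (q : R) (C : DeltaPlus k) :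
    φ (C.qWeight q) = C.qWeight (φ q) := by
  simp [DeltaPlus.qWeight]

theorem map_thetaSum {S : Type*} [CommRing S] (φ : R →+* S) (q : R) (k : ℕ) :
    φ (thetaSum q k) = thetaSum (φ q) k := by
  simp [thetaSum]

theorem sum_qWeight_eq_thetaSum (q : R) (k : ℕ) :
    ∑ C : DeltaPlus k, C.qWeight q = thetaSum q k := by
  have hX : ∑ C : DeltaPlus k, C.qWeight (Polynomial.X : Polynomial ℤ) =
      thetaSum (Polynomial.X : Polynomial ℤ) k := by
    have hinj := IsFractionRing.injective (Polynomial ℤ) (FractionRing (Polynomial ℤ))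
    apply hinj
    rw [map_sum, map_thetaSum]
    simp only [map_qWeight]
    refine sum_qWeight_of_field ?_ ?_ k
    · rw [Ne, map_eq_zero_iff _ hinj]
      exact Polynomial.X_ne_zero
    · rw [← map_pow, ← map_one (algebraMap (Polynomial ℤ) _), hinj.ne_iff]
      intro h
      have := congrArg Polynomial.natDegree h
      simp at this
  have h := congrArg (Polynomial.eval₂RingHom (Int.castRingHom R) q) hX
  rw [map_sum, map_thetaSum] at h
  simpa only [map_qWeight, Polynomial.coe_eval₂RingHom, Polynomial.eval₂_X] using h

end DeltaConfig

theorem mainTheorem3 {R : Type*} [CommRing R] (q : R) :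
    (∀ k : ℕ, ∑ C : DeltaConfig.DeltaPlus k, C.qWeight q =
      ∑ i ∈ Finset.Icc (-(k : ℤ)) (k : ℤ), (-q) ^ (i.natAbs ^ 2)) ∧
    (∃ C₀ : DeltaConfig.DeltaPlus 0, C₀.shape = ⊥ ∧ C₀.arrows = ∅ ∧ C₀.qWeight q = 1 ∧
      ∀ C : DeltaConfig.DeltaPlus 0, C = C₀) ∧
    (∀ k : ℕ, 1 ≤ k → ∑ C : DeltaConfig.DeltaPlus k, C.qWeight q =
      (∑ C : DeltaConfig.DeltaPlus (k - 1), C.qWeight q) + 2 * (-q) ^ (k ^ 2)) := by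
  refine ⟨fun k => DeltaConfig.sum_qWeight_eq_thetaSum q k, ?_, fun k hk => ?_⟩
  · refine ⟨⟨⊥, ∅, bot_le, by simp⟩, rfl, rfl, ?_, fun C => DeltaConfig.DeltaPlus.ext ?_ ?_⟩
    · simp [DeltaConfig.DeltaPlus.qWeight, DeltaConfig.DeltaPlus.arrowNorm, YoungDiagram.card]
    · rw [eq_bot_iff]
      intro c hc
      have := DeltaConfig.mem_staircase.1 (C.shape_le hc)
      omega
    · exact Finset.eq_empty_of_isEmpty _
  · obtain ⟨k, rfl⟩ := Nat.exists_eq_add_of_le' hk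
    rw [Nat.add_sub_cancel, DeltaConfig.sum_qWeight_eq_thetaSum,
      DeltaConfig.sum_qWeight_eq_thetaSum, DeltaConfig.thetaSum_succ]
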